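/- Let $K$ be a field of characteristic $0$. A (right) pre-Lie algebra is a $K$-vector space with a bilinear product $\circ$ satisfying $(x\circ y)\circ z-x\circ(y\circ z)=(x\circ z)\circ y-x\circ(z\circ y)$. A nonassociative permutative (NAP) coalgebra is a $K$-vector space $C$ with a linear map $\Delta:C\to C\otimes C$ such that $(\Delta\otimes\mathrm{id})\Delta=\tau_{23}(\Delta\otimes\mathrm{id})\Delta$, where $\tau_{23}(a\otimes b\otimes c)=a\otimes c\otimes b$. Put $\operatorname{Prim}C=C_1=\ker\Delta$ and $C_n=\{x\in C:\Delta(x)\in\sum_{i=1}^{n-1}C_i\otimes C_{n-i}\}$; the coalgebra is connected if $C=\bigcup_{n\ge1}C_n$. For a vector space $V$ let $\mathcal{RT}(V)=\bigoplus_{n\ge1}\mathcal{RT}(n)\otimes_{\Sigma_n}V^{\otimes n}$, where $\mathcal{RT}(n)$ is spanned by the rooted trees with vertices labeled bijectively by $\{1,\dots,n\}$; that is, $\mathcal{RT}(V)$ is spanned by the finite rooted (non-planar) trees with vertices decorated by elements of $V$, modulo linearity in the decoration of each vertex. Write $B(v,T_1,\dots,T_n)$ for the tree with root decorated by $v$ and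 with subtrees $T_1,\dots,T_n$ at the root. Equip $\mathcal{RT}(V)$ with the product $S\circ T=\sum_{u\in\operatorname{Vert}(S)}S\circ_uT$, where $S\circ_uT$ is obtained by grafting the root of $T$ on the vertex $u$ of $S$, and with the coproduct $\Delta(B(v,T_1,\dots,T_n))=\sum_{i=1}^nB(v,T_1,\dots,\widehat{T_i},\dots,T_n)\otimes T_i$. Theorem. Let $H$ be a pre-Lie algebra over $K$ with a connected NAP coproduct $\Delta_H$ such that for all $a,b\in H$ $$\Delta_H(a\circ b)=a\otimes b+\Delta_H(a)\circ b,\qquad\text{where } (x\otimes y)\circ b=(x\circ b)\otimes y+x\otimes(y\circ b).$$ Then: 1. There is a linear isomorphism $\Phi:\mathcal{RT}(\operatorname{Prim}H)\to H$ which is at the same time an isomorphism of pre-Lie algebras and of NAP coalgebras, $\Phi(S\circ T)=\Phi(S)\circ\Phi(T)$ and $\Delta_H\Phi=(\Phi\otimes\Phi)\Delta$, and which sends the one-vertex tree decorated by $v$ to $v$, for every $v\in\operatorname{Prim}H$. 2. $H$ is the free pre-Lie algebra on $\operatorname{Prim}H$: every linear map from $\operatorname{Prim}H$ to a pre-Lie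 algebra $L$ over $K$ extends uniquely to a morphism of pre-Lie algebras $H\to L$. 3. $H$ is the cofree connected NAP coalgebra on $\operatorname{Prim}H$: there is a linear projection $p:H\to\operatorname{Prim}H$ (the identity on $\operatorname{Prim}H$) such that for every connected NAP coalgebra $C$ over $K$ and every linear map $f:C\to\operatorname{Prim}H$ there is a unique morphism of NAP coalgebras $F:C\to H$ with $p\circ F=f$. -/

import Mathlib

open scoped TensorProduct

set_option linter.unusedSectionVars false

/-! ### Nonassociative permutative (NAP) coalgebras -/

namespace NAP

section Coalgebra

variable {K : Type*} [Field K] {C : Type*} [AddCommGroup C] [Module K C]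

/-- `Δ` is a nonassociative permutative coproduct: `(1 - τ₂₃) (Δ ⊗ id) Δ = 0`, where
`τ₂₃ (a ⊗ b ⊗ c) = a ⊗ c ⊗ b`. -/
def IsNAPCoproduct (Δ : C →ₗ[K] C ⊗[K] C) : Prop :=
  ∀ x : C, TensorProduct.rightComm K C C C (Δ.rTensor C (Δ x)) = Δ.rTensor C (Δ x)

/-- The space of primitive elements `Prim C = {x | Δ x = 0}`. -/
def Prim (Δ : C →ₗ[K] C ⊗[K] C) : Submodule K C := LinearMap.ker Δ

/-- The filtration `C₁ ⊆ C₂ ⊆ …` attached to a coproduct: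
`Cₙ = {x | Δ x ∈ ∑_{i=1}^{n-1} Cᵢ ⊗ Cₙ₋ᵢ}`; in particular `C₁ = Prim C`.
The index `i : Fin (n - 1)` below stands for `i + 1 ∈ {1, …, n - 1}`.
Only the indices `n ≥ 1` are meaningful. -/
def filtration (Δ : C →ₗ[K] C ⊗[K] C) (n : ℕ) : Submodule K C :=
  Submodule.comap Δ
    (⨆ i : Fin (n - 1), LinearMap.range
      (TensorProduct.mapIncl (filtration Δ (i + 1)) (filtration Δ (n - (i + 1)))))
termination_by n
decreasing_by all_goals omega

/-- The coproduct is connected: `C = ⋃_{n ≥ 1} Cₙ`. -/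
def IsConnected (Δ : C →ₗ[K] C ⊗[K] C) : Prop :=
  ∀ x : C, ∃ n : ℕ, 1 ≤ n ∧ x ∈ filtration Δ n

end Coalgebra

section Compatibility

variable {K : Type*} [Field K] {H : Type*} [RightPreLieRing H] [RightPreLieAlgebra K H]

/-- The right action of `b ∈ H` on `H ⊗ H` by derivation:
`(x ⊗ y) ∘ b = (x ∘ b) ⊗ y + x ⊗ (y ∘ b)`. -/
noncomputable def tensorAct (K : Type*) [Field K] {H : Type*} [RightPreLieRing H]
    [RightPreLieAlgebra K H] (b : H) : H ⊗[K] H →ₗ[K] H ⊗[K] H :=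
  (LinearMap.mulRight K b).rTensor H + (LinearMap.mulRight K b).lTensor H

/-- The distributive law `Δ (a ∘ b) = a ⊗ b + Δ(a) ∘ b`. -/
def IsCompatible (Δ : H →ₗ[K] H ⊗[K] H) : Prop :=
  ∀ a b : H, Δ (a * b) = a ⊗ₜ[K] b + tensorAct K b (Δ a)

end Compatibility

/-! ### Decorated rooted trees -/

/-- Finite rooted trees with vertices decorated by `X` and with, at each vertex, a chosen
ordering of the children: `node r [T₁, …, Tₖ]` represents `B(r, T₁, …, Tₖ)`.
The orderings are forgotten in `RT` below. -/
inductive PTree (X : Type*) where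
  | node : X → List (PTree X) → PTree X

namespace PTree

variable {X : Type*}

mutual

/-- The list of all trees `S ∘ᵥ T`, `v` running through the vertices of `S`, where `S ∘ᵥ T` is
obtained by grafting the root of `T` on the vertex `v` of `S`. -/
def grafts : PTree X → PTree X → List (PTree X)
  | node r l, T => node r (T :: l) :: (forestGrafts l T).map (node r)

/-- The list of all forests obtained by grafting the root of `T` on a vertex of the given
forest. -/
def forestGrafts : List (PTree X) → PTree X → List (List (PTree X))
  | [], _ => []
  | S :: l, T => (grafts S T).map (fun S' => S' :: l) ++ (forestGrafts l T).map (fun f => S :: f)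

end

end PTree

open PTree

section RootedTrees

variable (K : Type*) [Field K] (V : Type*) [AddCommGroup V] [Module K V]

/-- The relations between formal linear combinations of `V`-decorated trees: trees which differ
by the order of the children of a vertex are equal (rooted trees are not planar), and a tree is
linear in the decoration of each of its vertices. -/
inductive RTRel : (PTree V →₀ K) → Prop
  | perm (v : V) (l l' : List (PTree V)) (h : l.Perm l') :
      RTRel (Finsupp.single (node v l) 1 - Finsupp.single (node v l') 1)
  | add_label (v w : V) (l : List (PTree V)) :
      RTRel (Finsupp.single (node (v + w) l) 1 - Finsupp.single (node v l) 1
        - Finsupp.single (node w l) 1)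
  | smul_label (c : K) (v : V) (l : List (PTree V)) :
      RTRel (Finsupp.single (node (c • v) l) 1 - c • Finsupp.single (node v l) 1)
  | child (v : V) (l : List (PTree V)) (x : PTree V →₀ K) (h : RTRel x) :
      RTRel (Finsupp.lmapDomain K K (fun T => node v (T :: l)) x)

/-- The space of rooted trees `RT(V) = ⨁_{n ≥ 1} RT(n) ⊗_{Σₙ} V^{⊗ n}`, where `RT(n)` is spanned
by the rooted trees with vertex set in bijection with `{1, …, n}`. The class of
`T ⊗ (v₁ ⊗ … ⊗ vₙ)` is the tree `T` with the vertex labeled `i` decorated by `vᵢ`; hence `RT(V)`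
is the space spanned by the rooted trees decorated by elements of `V`, subject to linearity in
each decoration. -/
abbrev RT : Type _ := (PTree V →₀ K) ⧸ Submodule.span K {x | RTRel K V x}

variable {V}

/-- The class in `RT(V)` of a decorated tree. -/
noncomputable def RT.tree (T : PTree V) : RT K V :=
  (Submodule.span K {x | RTRel K V x}).mkQ (Finsupp.single T 1)

variable {K}

namespace RT

theorem mkQ_eq_zero {x : PTree V →₀ K} (h : RTRel K V x) :
    (Submodule.span K {x | RTRel K V x}).mkQ x = 0 :=
  (Submodule.Quotient.mk_eq_zero _).2 (Submodule.subset_span h)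

theorem tree_perm (v : V) {l l' : List (PTree V)} (h : l.Perm l') :
    tree K (node v l) = tree K (node v l') := by
  have := mkQ_eq_zero (RTRel.perm (K := K) v l l' h)
  rw [map_sub, sub_eq_zero] at this
  exact this

theorem tree_add_label (v w : V) (l : List (PTree V)) :
    tree K (node (v + w) l) = tree K (node v l) + tree K (node w l) := by
  have := mkQ_eq_zero (RTRel.add_label (K := K) v w l)
  rw [map_sub, map_sub, sub_sub, sub_eq_zero] at this
  exact this

theorem tree_smul_label (c : K) (v : V) (l : List (PTree V)) :
    tree K (node (c • v) l) = c • tree K (node v l) := by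
  have := mkQ_eq_zero (RTRel.smul_label (K := K) c v l)
  rw [map_sub, map_smul, sub_eq_zero] at this
  exact this

/-- A map on decorated trees which respects the relations extends linearly to `RT(V)`. -/
noncomputable def lift {M : Type*} [AddCommGroup M] [Module K M] (f : PTree V → M)
    (h : ∀ x, RTRel K V x → Finsupp.linearCombination K f x = 0) : RT K V →ₗ[K] M :=
  (Submodule.span K {x | RTRel K V x}).liftQ (Finsupp.linearCombination K f)
    (Submodule.span_le.2 fun x hx => h x hx)

theorem lift_tree {M : Type*} [AddCommGroup M] [Module K M] (f : PTree V → M)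
    (h : ∀ x, RTRel K V x → Finsupp.linearCombination K f x = 0) (T : PTree V) :
    lift f h (tree K T) = f T := by
  simp [lift, tree]

/-- The linear map `RT(V) → RT(V)` attaching its argument as a further child of the root of
`B(v, T₁, …, Tₖ)`. -/
noncomputable def attach (v : V) (l : List (PTree V)) : RT K V →ₗ[K] RT K V :=
  lift (fun T => tree K (node v (T :: l))) fun x hx => by
    have h := mkQ_eq_zero (RTRel.child v l x hx)
    rw [← h, Finsupp.lmapDomain_apply, Finsupp.mapDomain, Finsupp.linearCombination_apply,
      Finsupp.sum, Finsupp.sum, map_sum]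
    refine Finset.sum_congr rfl fun T _ => ?_
    rw [tree, ← map_smul, Finsupp.smul_single, smul_eq_mul, mul_one]

theorem attach_tree (v : V) (l : List (PTree V)) (T : PTree V) :
    attach v l (tree K T) = tree K (node v (T :: l)) := lift_tree _ _ _

theorem linearCombination_tree (x : PTree V →₀ K) :
    Finsupp.linearCombination K (tree K) x
      = (Submodule.span K {x | RTRel K V x}).mkQ x := by
  have : Finsupp.linearCombination K (tree K (V := V))
      = (Submodule.span K {x | RTRel K V x}).mkQ := by
    ext T
    simp [tree]
  rw [this]

theorem linearCombination_comp {M N : Type*} [AddCommGroup M] [Module K M] [AddCommGroup N]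
    [Module K N] (A : M →ₗ[K] N) (g : PTree V → M) (x : PTree V →₀ K) :
    Finsupp.linearCombination K (fun T => A (g T)) x = A (Finsupp.linearCombination K g x) := by
  rw [Finsupp.apply_linearCombination]; rfl

theorem linearCombination_tree_comp {M : Type*} [AddCommGroup M] [Module K M]
    (A : RT K V →ₗ[K] M) {x : PTree V →₀ K} (h : RTRel K V x) :
    Finsupp.linearCombination K (fun T => A (tree K T)) x = 0 := by
  rw [linearCombination_comp, linearCombination_tree, mkQ_eq_zero h, map_zero]

theorem linearCombination_add_fun {M : Type*} [AddCommGroup M] [Module K M]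
    (f g : PTree V → M) (x : PTree V →₀ K) :
    Finsupp.linearCombination K (fun T => f T + g T) x
      = Finsupp.linearCombination K f x + Finsupp.linearCombination K g x := by
  simp [Finsupp.linearCombination_apply, Finsupp.sum, Finset.sum_add_distrib]

variable (K) in
/-- The sum of the trees `S ∘ᵥ T` over the vertices `v` of `S`. -/
noncomputable def graftSum (S T : PTree V) : RT K V :=
  ((grafts S T).map (tree K)).sum

variable (K) in
/-- The sum of the trees `B(v, p, f)` over the forests `f` obtained by grafting `T` on `l`. -/
noncomputable def forestSum (v : V) (p l : List (PTree V)) (T : PTree V) : RT K V :=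
  ((forestGrafts l T).map fun f => tree K (node v (p ++ f))).sum

theorem graftSum_node (v : V) (l : List (PTree V)) (T : PTree V) :
    graftSum K (node v l) T = attach v l (tree K T) + forestSum K v [] l T := by
  simp [graftSum, forestSum, grafts, attach_tree, Function.comp_def]

theorem tree_insert (v : V) (p l : List (PTree V)) (S : PTree V) :
    tree K (node v (p ++ S :: l)) = attach v (p ++ l) (tree K S) := by
  rw [attach_tree]
  exact tree_perm v List.perm_middle

theorem forestSum_cons (v : V) (p l : List (PTree V)) (S T : PTree V) :
    forestSum K v p (S :: l) T
      = attach v (p ++ l) (graftSum K S T) + forestSum K v (p ++ [S]) l T := by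
  simp only [forestSum, forestGrafts, List.map_append, List.map_map, List.sum_append, graftSum,
    map_list_sum, Function.comp_def, List.append_assoc, List.cons_append, List.nil_append,
    tree_insert]

mutual

theorem graftSum_right {x : PTree V →₀ K} (h : RTRel K V x) :
    ∀ S : PTree V, Finsupp.linearCombination K (fun T => graftSum K S T) x = 0
  | node v l => by
    simp only [graftSum_node]
    rw [linearCombination_add_fun, linearCombination_tree_comp _ h, forestSum_right h l, add_zero]

theorem forestSum_right {x : PTree V →₀ K} (h : RTRel K V x) :
    ∀ (l : List (PTree V)) (v : V) (p : List (PTree V)),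
      Finsupp.linearCombination K (fun T => forestSum K v p l T) x = 0
  | [], v, p => by simp [forestSum, forestGrafts, Finsupp.linearCombination_apply]
  | S :: l, v, p => by
    simp only [forestSum_cons]
    rw [linearCombination_add_fun, linearCombination_comp, graftSum_right h S,
      forestSum_right h l, map_zero, add_zero]

end

theorem attach_perm (v : V) {l l' : List (PTree V)} (h : l.Perm l') :
    attach (K := K) v l = attach v l' := by
  ext T
  change attach v l (tree K T) = attach v l' (tree K T)
  rw [attach_tree, attach_tree]
  exact tree_perm v (h.cons T)

theorem forestSum_perm_left (v : V) {p p' : List (PTree V)} (h : p.Perm p')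
    (l : List (PTree V)) (T : PTree V) : forestSum K v p l T = forestSum K v p' l T := by
  unfold forestSum
  congr 2
  funext f
  exact tree_perm v (h.append_right f)

theorem forestSum_perm (v : V) {l l' : List (PTree V)} (h : l.Perm l') (T : PTree V) :
    ∀ p, forestSum K v p l T = forestSum K v p l' T := by
  induction h with
  | nil => intro p; rfl
  | cons S h ih =>
    intro p
    rw [forestSum_cons, forestSum_cons, ih, attach_perm v (h.append_left p)]
  | swap S S' l =>
    intro p
    simp only [forestSum_cons]
    rw [forestSum_perm_left v (p := p ++ [S'] ++ [S]) (p' := p ++ [S] ++ [S'])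
      (by simpa using List.Perm.append_left p (List.Perm.swap S S' [])), ← add_assoc, ← add_assoc]
    congr 1
    rw [add_comm]
    simp
  | trans _ _ ih₁ ih₂ => intro p; rw [ih₁, ih₂]

theorem graftSum_left {x : PTree V →₀ K} (h : RTRel K V x) (T : PTree V) :
    Finsupp.linearCombination K (fun S => graftSum K S T) x = 0 := by
  induction h with
  | perm v l l' h =>
    simp only [map_sub, Finsupp.linearCombination_single, one_smul, graftSum_node]
    rw [attach_perm v h, forestSum_perm v h, sub_self]
  | add_label v w l =>
    simp only [map_sub, Finsupp.linearCombination_single, one_smul, graftSum_node, attach_tree,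
      tree_add_label, forestSum, List.sum_map_add]
    abel
  | smul_label c v l =>
    simp only [map_sub, map_smul, Finsupp.linearCombination_single, one_smul, graftSum_node,
      attach_tree, tree_smul_label, forestSum, List.smul_sum, List.map_map, Function.comp_def,
      smul_add, sub_self]
  | child v l x h ih =>
    let A : RT K V →ₗ[K] RT K V :=
      attach v (T :: l) + ((forestGrafts l T).map fun f => attach v f).sum
    have key : ∀ S, graftSum K (node v (S :: l)) T
        = A (tree K S) + attach v l (graftSum K S T) := by
      intro S
      have e : ∀ L : List (List (PTree V)),
          (L.map fun f => attach (K := K) v f).sum (tree K S)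
            = (L.map fun f => tree K (node v (S :: f))).sum := by
        intro L
        induction L with
        | nil => simp
        | cons f L ih => simp [ih, attach_tree]
      rw [graftSum_node, forestSum_cons, LinearMap.add_apply, e, attach_tree, attach_tree,
        tree_perm v (List.Perm.swap S T l)]
      simp only [forestSum, List.nil_append, List.cons_append]
      abel
    rw [Finsupp.lmapDomain_apply, Finsupp.linearCombination_mapDomain]
    simp only [Function.comp_def, key]
    rw [linearCombination_add_fun, linearCombination_tree_comp A h, linearCombination_comp, ih,
      map_zero, add_zero]

variable (K V) in
/-- The pre-Lie product of `RT(V)`: the bilinear map with `S ∘ T = ∑_{v ∈ Vert(S)} S ∘ᵥ T` for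
decorated trees `S` and `T`. -/
noncomputable def graft : RT K V →ₗ[K] RT K V →ₗ[K] RT K V :=
  lift (fun S => lift (graftSum K S) fun x hx => graftSum_right hx S) fun x hx => by
    ext T
    change (Finsupp.linearCombination K
      (fun S => lift (graftSum K S) fun x hx => graftSum_right hx S) x) (tree K T) = 0
    refine Eq.trans ?_ (graftSum_left hx T)
    simp only [Finsupp.linearCombination_apply, Finsupp.sum, LinearMap.sum_apply,
      LinearMap.smul_apply, lift_tree]

theorem graft_tree (S T : PTree V) :
    graft K V (tree K S) (tree K T) = ((grafts S T).map (tree K)).sum := by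
  rw [graft, lift_tree, lift_tree, graftSum]

variable (K) in
/-- The sum `∑ᵢ B(v, p, T₁, …, T̂ᵢ, …, Tₙ) ⊗ Tᵢ`. -/
noncomputable def cutSum (v : V) (p l : List (PTree V)) : RT K V ⊗[K] RT K V :=
  ∑ i : Fin l.length, tree K (node v (p ++ l.eraseIdx i)) ⊗ₜ[K] tree K (l.get i)

variable (K) in
/-- The coproduct of a decorated tree:
`Δ(B(v, T₁, …, Tₙ)) = ∑_{i=1}^n B(v, T₁, …, T̂ᵢ, …, Tₙ) ⊗ Tᵢ`. -/
noncomputable def cut : PTree V → RT K V ⊗[K] RT K V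
  | node v l => ∑ i : Fin l.length, tree K (node v (l.eraseIdx i)) ⊗ₜ[K] tree K (l.get i)

theorem cut_node (v : V) (l : List (PTree V)) : cut K (node v l) = cutSum K v [] l := by
  simp [cut, cutSum]

theorem cutSum_cons (v : V) (p l : List (PTree V)) (S : PTree V) :
    cutSum K v p (S :: l)
      = tree K (node v (p ++ l)) ⊗ₜ[K] tree K S + cutSum K v (p ++ [S]) l := by
  unfold cutSum
  rw [show (∑ i : Fin (S :: l).length, tree K (node v (p ++ (S :: l).eraseIdx i)) ⊗ₜ[K]
    tree K ((S :: l).get i)) = _ from Fin.sum_univ_succ (n := l.length) _]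
  simp

theorem cutSum_perm_left (v : V) {p p' : List (PTree V)} (h : p.Perm p')
    (l : List (PTree V)) : cutSum K v p l = cutSum K v p' l := by
  unfold cutSum
  refine Finset.sum_congr rfl fun i _ => ?_
  rw [tree_perm v (h.append_right _)]

theorem cutSum_perm (v : V) {l l' : List (PTree V)} (h : l.Perm l') :
    ∀ p, cutSum K v p l = cutSum K v p l' := by
  induction h with
  | nil => intro p; rfl
  | cons S h ih =>
    intro p
    rw [cutSum_cons, cutSum_cons, ih, tree_perm v (h.append_left p)]
  | swap S S' l =>
    intro p
    simp only [cutSum_cons]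
    rw [cutSum_perm_left v (p := p ++ [S'] ++ [S]) (p' := p ++ [S] ++ [S'])
      (by simpa using List.Perm.append_left p (List.Perm.swap S S' [])), ← add_assoc, ← add_assoc]
    congr 1
    rw [add_comm]
    simp
  | trans _ _ ih₁ ih₂ => intro p; rw [ih₁, ih₂]

theorem cut_rel (x : PTree V →₀ K) (h : RTRel K V x) :
    Finsupp.linearCombination K (cut K) x = 0 := by
  induction h with
  | perm v l l' h =>
    simp only [map_sub, Finsupp.linearCombination_single, one_smul, cut_node]
    rw [cutSum_perm v h, sub_self]
  | add_label v w l =>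
    simp only [map_sub, Finsupp.linearCombination_single, one_smul, cut,
      tree_add_label, TensorProduct.add_tmul, Finset.sum_add_distrib]
    abel
  | smul_label c v l =>
    simp only [map_sub, map_smul, Finsupp.linearCombination_single, one_smul, cut,
      tree_smul_label, ← TensorProduct.smul_tmul', Finset.smul_sum, sub_self]
  | child v l x h ih =>
    let A : RT K V →ₗ[K] RT K V ⊗[K] RT K V :=
      TensorProduct.mk K _ _ (tree K (node v l)) +
        ∑ i : Fin l.length,
          (TensorProduct.mk K _ _).flip (tree K (l.get i)) ∘ₗ attach v (l.eraseIdx i)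
    have key : ∀ S, cut K (node v (S :: l)) = A (tree K S) := by
      intro S
      rw [cut_node, cutSum_cons]
      simp [A, cutSum, attach_tree]
    rw [Finsupp.lmapDomain_apply, Finsupp.linearCombination_mapDomain]
    simp only [Function.comp_def, key]
    exact linearCombination_tree_comp A h

variable (K V) in
/-- The nonassociative permutative coproduct of `RT(V)`: the linear map with
`Δ(B(v, T₁, …, Tₙ)) = ∑_{i=1}^n B(v, T₁, …, T̂ᵢ, …, Tₙ) ⊗ Tᵢ`. -/
noncomputable def coproduct : RT K V →ₗ[K] RT K V ⊗[K] RT K V :=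
  lift (cut K) cut_rel

theorem coproduct_tree (v : V) (l : List (PTree V)) :
    coproduct K V (tree K (node v l))
      = ∑ i : Fin l.length, tree K (node v (l.eraseIdx i)) ⊗ₜ[K] tree K (l.get i) := by
  rw [coproduct, lift_tree, cut]

end RT

end RootedTrees

end NAP

namespace NAP

/-! ### Functions of lists -/

section Multilinear

variable {K : Type*} [Field K] {A : Type*} [AddCommGroup A] [Module K A]
  {M : Type*} [AddCommGroup M] [Module K M] {N : Type*} [AddCommGroup N] [Module K N]

/-- A function of lists which is linear in each entry of the list. -/
def IsMultilinear (K : Type*) [Field K] {A : Type*} [AddCommGroup A] [Module K A]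
    {M : Type*} [AddCommGroup M] [Module K M] (f : List A → M) : Prop :=
  ∀ p s : List A, IsLinearMap K fun y => f (p ++ y :: s)

theorem IsMultilinear.cons {f : List A → M} (hf : IsMultilinear K f) (y : A) :
    IsMultilinear K fun l => f (y :: l) :=
  fun p s => hf (y :: p) s

theorem IsMultilinear.comp {f : List A → M} (hf : IsMultilinear K f) (φ : M →ₗ[K] N) :
    IsMultilinear K fun l => φ (f l) :=
  fun p s => (φ.comp ((hf p s).mk' _)).isLinear

theorem IsMultilinear.map_cons_add {f : List A → M} (hf : IsMultilinear K f) (y z : A)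
    (l : List A) : f ((y + z) :: l) = f (y :: l) + f (z :: l) :=
  (hf [] l).map_add y z

end Multilinear

section Leibniz

variable {A : Type*} [Mul A] {M : Type*} [AddCommGroup M] {N : Type*} [AddCommGroup N]

/-- The sum of the values of `f` at the lists obtained from a given list by multiplying
one entry by `x` on the right. -/
def leibniz (x : A) : (List A → M) → List A → M
  | _, [] => 0
  | f, y :: l => f ((y * x) :: l) + leibniz x (fun l' => f (y :: l')) l

@[simp] theorem leibniz_nil (x : A) (f : List A → M) : leibniz x f [] = 0 := rfl

theorem leibniz_cons (x : A) (f : List A → M) (y : A) (l : List A) :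
    leibniz x f (y :: l) = f ((y * x) :: l) + leibniz x (fun l' => f (y :: l')) l := rfl

theorem leibniz_congr (x : A) {f g : List A → M} {l : List A}
    (h : ∀ l', l'.length = l.length → f l' = g l') : leibniz x f l = leibniz x g l := by
  induction l generalizing f g with
  | nil => rfl
  | cons y l ih =>
    rw [leibniz_cons, leibniz_cons, h _ (by simp), ih fun l' hl => h _ (by simp [hl])]

theorem leibniz_map (x : A) (φ : M →+ N) (f : List A → M) (l : List A) :
    leibniz x (fun l' => φ (f l')) l = φ (leibniz x f l) := by
  induction l generalizing f with
  | nil => simp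
  | cons y l ih => rw [leibniz_cons, leibniz_cons, ih, map_add]

theorem leibniz_add (x : A) (f g : List A → M) (l : List A) :
    leibniz x (fun l' => f l' + g l') l = leibniz x f l + leibniz x g l := by
  induction l generalizing f g with
  | nil => simp
  | cons y l ih => simp only [leibniz_cons, ih]; abel

theorem leibniz_sub (x : A) (f g : List A → M) (l : List A) :
    leibniz x (fun l' => f l' - g l') l = leibniz x f l - leibniz x g l := by
  induction l generalizing f g with
  | nil => simp
  | cons y l ih => simp only [leibniz_cons, ih]; abel

theorem leibniz_zero (x : A) (l : List A) : leibniz x (fun _ => (0 : M)) l = 0 := by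
  simpa using leibniz_sub x (fun _ => (0 : M)) (fun _ => 0) l

theorem leibniz_perm (x : A) {f : List A → M} (hf : ∀ l l', l.Perm l' → f l = f l')
    {l l' : List A} (h : l.Perm l') : leibniz x f l = leibniz x f l' := by
  induction h generalizing f with
  | nil => rfl
  | cons y h ih =>
    rw [leibniz_cons, leibniz_cons, hf _ _ (h.cons _), ih fun _ _ h' => hf _ _ (h'.cons y)]
  | swap y z l =>
    simp only [leibniz_cons]
    rw [hf _ _ (List.Perm.swap y (z * x) l), hf _ _ (List.Perm.swap (y * x) z l),
      leibniz_congr (l := l) x fun l' _ => hf _ _ (List.Perm.swap y z l')]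
    abel
  | trans _ _ ih₁ ih₂ => rw [ih₁ hf, ih₂ hf]

end Leibniz

section LeibnizLinear

variable {K : Type*} [Field K] {A : Type*} [NonUnitalNonAssocRing A] [Module K A]
  [IsScalarTower K A A] [SMulCommClass K A A] {M : Type*} [AddCommGroup M] [Module K M]

theorem leibniz_smul (x : A) (c : K) (f : List A → M) (l : List A) :
    leibniz x (fun l' => c • f l') l = c • leibniz x f l :=
  leibniz_map x (DistribSMul.toAddMonoidHom M c) f l

theorem IsMultilinear.leibniz_left {f : List A → M} (hf : IsMultilinear K f) (l : List A) :
    IsLinearMap K fun x => leibniz x f l := by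
  induction l generalizing f with
  | nil => exact ⟨by simp, by simp⟩
  | cons y l ih =>
    have h := ih (hf.cons y)
    refine ⟨fun x x' => ?_, fun c x => ?_⟩
    · simp only [leibniz_cons]
      rw [h.map_add, mul_add, hf.map_cons_add]
      abel
    · simp only [leibniz_cons]
      have e := (hf [] l).map_smul c (y * x)
      simp only [List.nil_append] at e
      rw [h.map_smul, mul_smul_comm, e, smul_add]

theorem IsMultilinear.leibniz {f : List A → M} (hf : IsMultilinear K f) (x : A) :
    IsMultilinear K (leibniz x f) := by
  intro p s
  induction p generalizing f with
  | nil =>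
    refine ⟨fun y z => ?_, fun c y => ?_⟩
    · simp only [List.nil_append, leibniz_cons, add_mul, hf.map_cons_add, leibniz_add]
      abel
    · have h : ∀ (y : A) (l : List A), f ((c • y) :: l) = c • f (y :: l) :=
        fun y l => (hf [] l).map_smul c y
      simp only [List.nil_append, leibniz_cons, smul_mul_assoc, h, leibniz_smul, smul_add]
  | cons q p ih =>
    have h := ih (hf.cons q)
    have h' := hf ((q * x) :: p) s
    refine ⟨fun y z => ?_, fun c y => ?_⟩
    · have e := h'.map_add y z
      simp only [List.cons_append] at e
      simp only [List.cons_append, leibniz_cons, h.map_add, e]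
      abel
    · have e := h'.map_smul c y
      simp only [List.cons_append] at e
      simp only [List.cons_append, leibniz_cons, h.map_smul, e, smul_add]

end LeibnizLinear

/-! ### Symmetric braces of a pre-Lie algebra -/

section Brace

variable (K : Type*) [Field K] {A : Type*} [RightPreLieRing A] [RightPreLieAlgebra K A]
  {M : Type*} [AddCommGroup M] [Module K M]

/-- The operators `x ↦ x{y₁, …, yₖ}` computed by at most `n` applications of the recursion of
the symmetric braces. -/
noncomputable def braceAux : ℕ → List A → A →ₗ[K] A
  | _, [] => LinearMap.id
  | 0, _ :: _ => 0
  | n + 1, y :: l => LinearMap.mulRight K y ∘ₗ braceAux n l - leibniz y (braceAux n) l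

/-- The symmetric brace `x ↦ x{y₁, …, yₖ}` of a right pre-Lie algebra, defined by
`x{} = x` and `x{y, y₁, …, yₖ} = x{y₁, …, yₖ} ∘ y - ∑ᵢ x{y₁, …, yᵢ ∘ y, …, yₖ}`. -/
noncomputable def brace (l : List A) : A →ₗ[K] A := braceAux K l.length l

theorem braceAux_zero_cons (y : A) (l : List A) : braceAux K 0 (y :: l) = 0 := rfl

theorem braceAux_succ_cons (n : ℕ) (y : A) (l : List A) :
    braceAux K (n + 1) (y :: l)
      = LinearMap.mulRight K y ∘ₗ braceAux K n l - leibniz y (braceAux K n) l := rfl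

theorem braceAux_eq_brace {n : ℕ} {l : List A} (h : l.length ≤ n) :
    braceAux K n l = brace K l := by
  induction n generalizing l with
  | zero =>
    obtain rfl : l = [] := List.length_eq_zero_iff.1 (by omega)
    rfl
  | succ n ih =>
    cases l with
    | nil => rfl
    | cons y l =>
      have h : l.length ≤ n := by simpa using h
      rw [brace, List.length_cons, braceAux_succ_cons, braceAux_succ_cons, ih h,
        leibniz_congr y fun l' hl => (ih (l := l') (by omega)).trans (by rw [brace, hl])]
      rfl

@[simp] theorem brace_nil : brace K ([] : List A) = LinearMap.id := rfl

theorem brace_cons_eq (y : A) (l : List A) :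
    brace K (y :: l) = LinearMap.mulRight K y ∘ₗ brace K l - leibniz y (brace K) l := by
  rw [brace, List.length_cons, braceAux_succ_cons, braceAux_eq_brace K le_rfl]
  rw [leibniz_congr y fun l' hl => braceAux_eq_brace K hl.le]

theorem leibniz_apply (y : A) (f : List A → A →ₗ[K] M) (l : List A) (a : A) :
    leibniz y f l a = leibniz y (fun l' => f l' a) l :=
  (leibniz_map y (LinearMap.applyₗ a : (A →ₗ[K] M) →ₗ[K] M).toAddMonoidHom f l).symm

theorem brace_cons (y : A) (l : List A) (a : A) :
    brace K (y :: l) a = brace K l a * y - leibniz y (fun l' => brace K l' a) l := by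
  rw [brace_cons_eq, LinearMap.sub_apply, leibniz_apply]
  rfl

theorem braceAux_multilinear (n : ℕ) : IsMultilinear K (braceAux K n (A := A)) := by
  induction n with
  | zero =>
    intro p s
    cases p <;> exact ⟨by simp [braceAux_zero_cons], by simp [braceAux_zero_cons]⟩
  | succ n ih =>
    intro p s
    cases p with
    | nil =>
      have h := ih.leibniz_left s
      refine ⟨fun y z => ?_, fun c y => ?_⟩
      · simp only [List.nil_append, braceAux_succ_cons, h.map_add]
        ext a
        simp [mul_add]
        abel
      · simp only [List.nil_append, braceAux_succ_cons, h.map_smul]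
        ext a
        simp [smul_sub, mul_smul_comm]
    | cons q p =>
      have h := ih.leibniz q p s
      have h' := ih p s
      refine ⟨fun y z => ?_, fun c y => ?_⟩
      · simp only [List.cons_append, braceAux_succ_cons, h.map_add, h'.map_add]
        ext a
        simp [add_mul]
        abel
      · simp only [List.cons_append, braceAux_succ_cons, h.map_smul, h'.map_smul]
        ext a
        simp [smul_sub]

theorem brace_multilinear : IsMultilinear K (brace K (A := A)) := by
  intro p s
  have h := braceAux_multilinear K (A := A) (p.length + s.length + 1) p s
  have e : ∀ y, braceAux K (p.length + s.length + 1) (p ++ y :: s) = brace K (p ++ y :: s) :=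
    fun y => braceAux_eq_brace K (by simp; omega)
  simpa only [e] using h

/-- Two derivations commute up to the derivation attached to the commutator. -/
theorem leibniz_leibniz {f : List A → M} (hf : IsMultilinear K f) (x y : A) (l : List A) :
    leibniz x (leibniz y f) l + leibniz (y * x) f l
      = leibniz y (leibniz x f) l + leibniz (x * y) f l := by
  induction l generalizing f with
  | nil => simp
  | cons z l ih =>
    have h := ih (hf.cons z)
    have e : (z * x) * y + z * (y * x) = (z * y) * x + z * (x * y) := by
      have := RightPreLieRing.assoc_symm z x y
      simp only [associator_apply] at this
      rw [sub_eq_sub_iff_add_eq_add] at this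
      exact this
    have e' := congrArg (fun t => f (t :: l)) e
    simp only [hf.map_cons_add] at e'
    simp only [leibniz_cons, leibniz_add]
    have key : ∀ a b c d a' b' c' d' s t : M, c + s = c' + t → a + b = a' + b' →
        a + d + (d' + c) + (b + s) = a' + d' + (d + c') + (b' + t) := by
      intro a b c d a' b' c' d' s t h₁ h₂
      calc _ = (a + b) + (c + s) + (d + d') := by abel
        _ = (a' + b') + (c' + t) + (d + d') := by rw [h₁, h₂]
        _ = _ := by abel
    exact key _ _ _ _ _ _ _ _ _ _ h e'

theorem braceAux_swap (n : ℕ) (x y : A) (l : List A) :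
    braceAux K n (x :: y :: l) = braceAux K n (y :: x :: l) := by
  match n with
  | 0 => rfl
  | 1 =>
    have : ∀ (x y : A) (l : List A), braceAux K 1 (x :: y :: l) = 0 := by
      intro x y l
      rw [braceAux_succ_cons, leibniz_cons]
      simp only [braceAux_zero_cons, leibniz_zero]
      simp
    rw [this, this]
  | n + 2 =>
    ext a
    have key : ∀ x y : A, braceAux K (n + 2) (x :: y :: l) a
        = ((braceAux K n l a * y) * x - braceAux K n l a * (y * x))
          - (leibniz y (fun l' => braceAux K n l' a) l * x
            + leibniz x (fun l' => braceAux K n l' a) l * y)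
          + (leibniz x (leibniz y fun l' => braceAux K n l' a) l
            + leibniz (y * x) (fun l' => braceAux K n l' a) l) := by
      intro x y
      have e := leibniz_map x (AddMonoidHom.mulRight y) (fun l' => braceAux K n l' a) l
      simp only [AddMonoidHom.coe_mulRight] at e
      rw [braceAux_succ_cons, leibniz_cons]
      simp only [braceAux_succ_cons, LinearMap.sub_apply, LinearMap.add_apply, leibniz_apply,
        LinearMap.comp_apply, LinearMap.mulRight_apply, sub_mul, leibniz_sub, e]
      simp only [← leibniz_apply]
      rw [leibniz_apply]
      simp only [leibniz_apply]
      abel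
    have hm : IsMultilinear K fun l' => braceAux K n l' a :=
      (braceAux_multilinear K n).comp (LinearMap.applyₗ a)
    have hs := RightPreLieRing.assoc_symm (braceAux K n l a) x y
    simp only [associator_apply] at hs
    rw [key, key, leibniz_leibniz K hm, hs]
    abel

theorem braceAux_perm (n : ℕ) {l l' : List A} (h : l.Perm l') :
    braceAux K n l = braceAux K n l' := by
  induction n generalizing l l' with
  | zero =>
    cases l with
    | nil => rw [List.nil_perm.1 h]
    | cons y l =>
      cases l' with
      | nil => simp at h
      | cons => rfl
  | succ n ih =>
    induction h with
    | nil => rfl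
    | cons y h =>
      rw [braceAux_succ_cons, braceAux_succ_cons, ih h, leibniz_perm y (fun _ _ => ih) h]
    | swap x y l => exact braceAux_swap K _ y x l
    | trans _ _ ih₁ ih₂ => rw [ih₁, ih₂]

theorem brace_perm {l l' : List A} (h : l.Perm l') : brace K l = brace K l' := by
  rw [brace, brace, h.length_eq, braceAux_perm K _ h]

theorem map_brace {B : Type*} [RightPreLieRing B] [RightPreLieAlgebra K B] (F : A →ₙₐ[K] B)
    (l : List A) (a : A) : F (brace K l a) = brace K (l.map F) (F a) := by
  have hl : ∀ (x : A) (g : List B → B) (l : List A),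
      leibniz x (fun l' => g (l'.map F)) l = leibniz (F x) g (l.map F) := by
    intro x g l
    induction l generalizing g with
    | nil => rfl
    | cons y l ih =>
      simp only [leibniz_cons, List.map_cons, map_mul]
      rw [← ih]
  induction hn : l.length generalizing l with
  | zero =>
    obtain rfl : l = [] := List.length_eq_zero_iff.1 hn
    rfl
  | succ n ih =>
    cases l with
    | nil => simp at hn
    | cons y l =>
      have hn : l.length = n := by simpa using hn
      rw [brace_cons, map_sub, map_mul, ih l hn, List.map_cons, brace_cons, ← hl]
      congr 1
      have := leibniz_map y (F : A →+ B) (fun l' => brace K l' a) l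
      refine this.symm.trans (leibniz_congr y fun l' h' => ?_)
      exact ih l' (h'.trans hn)

end Brace

/-! ### The coproduct of a brace -/

section Cut

variable (K : Type*) [Field K] {A : Type*} [RightPreLieRing A] [RightPreLieAlgebra K A]

/-- The sum `∑ᵢ f(y₁, …, ŷᵢ, …, yₖ) ⊗ yᵢ`. -/
noncomputable def listCut : (List A → A) → List A → A ⊗[K] A
  | _, [] => 0
  | f, y :: l => f l ⊗ₜ[K] y + listCut (fun l' => f (y :: l')) l

@[simp] theorem listCut_nil (f : List A → A) : listCut K f [] = 0 := rfl

theorem listCut_cons (f : List A → A) (y : A) (l : List A) :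
    listCut K f (y :: l) = f l ⊗ₜ[K] y + listCut K (fun l' => f (y :: l')) l := rfl

theorem listCut_add (f g : List A → A) (l : List A) :
    listCut K (fun l' => f l' + g l') l = listCut K f l + listCut K g l := by
  induction l generalizing f g with
  | nil => simp
  | cons y l ih => simp only [listCut_cons, ih, TensorProduct.add_tmul]; abel

theorem listCut_map (φ : A →ₗ[K] A) (f : List A → A) (l : List A) :
    listCut K (fun l' => φ (f l')) l = φ.rTensor A (listCut K f l) := by
  induction l generalizing f with
  | nil => simp
  | cons y l ih => simp only [listCut_cons, ih, map_add, LinearMap.rTensor_tmul]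

theorem listCut_sub (f g : List A → A) (l : List A) :
    listCut K (fun l' => f l' - g l') l = listCut K f l - listCut K g l := by
  rw [eq_sub_iff_add_eq, ← listCut_add]
  simp

theorem leibniz_listCut (x : A) (f : List A → A) (l : List A) :
    leibniz x (listCut K f) l
      = listCut K (leibniz x f) l + (LinearMap.mulRight K x).lTensor A (listCut K f l) := by
  induction l generalizing f with
  | nil => simp
  | cons y l ih =>
    have e := leibniz_map x (TensorProduct.mk K A A |>.flip y).toAddMonoidHom f l
    simp only [LinearMap.toAddMonoidHom_coe, LinearMap.flip_apply, TensorProduct.mk_apply] at e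
    simp only [leibniz_cons, listCut_cons, leibniz_add, listCut_add, map_add, ih, e,
      LinearMap.lTensor_tmul, LinearMap.mulRight_apply]
    abel

variable {K}

theorem coproduct_brace {Δ : A →ₗ[K] A ⊗[K] A} (h : IsCompatible Δ) {v : A} (hv : Δ v = 0)
    (l : List A) : Δ (brace K l v) = listCut K (fun l' => brace K l' v) l := by
  induction hn : l.length generalizing l with
  | zero =>
    obtain rfl : l = [] := List.length_eq_zero_iff.1 hn
    simpa using hv
  | succ n ih =>
    cases l with
    | nil => simp at hn
    | cons y l =>
      have hn : l.length = n := by simpa using hn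
      have e : Δ (leibniz y (fun l' => brace K l' v) l)
          = leibniz y (listCut K fun l' => brace K l' v) l := by
        rw [← LinearMap.toAddMonoidHom_coe, ← leibniz_map]
        exact leibniz_congr y fun l' h' => ih l' (h'.trans hn)
      rw [brace_cons, map_sub, h, e, ih l hn, leibniz_listCut, listCut_cons]
      simp only [brace_cons, listCut_sub]
      rw [tensorAct, LinearMap.add_apply, ← listCut_map]
      simp only [LinearMap.mulRight_apply]
      abel

end Cut

/-! ### Evaluation of trees in a pre-Lie algebra -/

section Eval

variable {K : Type*} [Field K] {V : Type*} [AddCommGroup V] [Module K V]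
  {A : Type*} [RightPreLieRing A] [RightPreLieAlgebra K A]

open PTree

mutual

/-- The value of a decorated tree in a pre-Lie algebra, where `B(v, T₁, …, Tₖ)` is evaluated to
the brace `f(v){T₁, …, Tₖ}`. -/
noncomputable def evalTree (f : V →ₗ[K] A) : PTree V → A
  | node v l => brace K (evalForest f l) (f v)

/-- The list of the values of the trees of a forest in a pre-Lie algebra. -/
noncomputable def evalForest (f : V →ₗ[K] A) : List (PTree V) → List A
  | [] => []
  | T :: l => evalTree f T :: evalForest f l

end

theorem evalForest_eq_map (f : V →ₗ[K] A) (l : List (PTree V)) :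
    evalForest f l = l.map (evalTree f) := by
  induction l with
  | nil => rw [evalForest, List.map_nil]
  | cons T l ih => rw [evalForest, List.map_cons, ih]

theorem evalTree_node (f : V →ₗ[K] A) (v : V) (l : List (PTree V)) :
    evalTree f (node v l) = brace K (l.map (evalTree f)) (f v) := by
  rw [evalTree, evalForest_eq_map]

mutual

theorem sum_evalTree_grafts (f : V →ₗ[K] A) (T : PTree V) : ∀ S : PTree V,
    ((grafts S T).map (evalTree f)).sum = evalTree f S * evalTree f T
  | node v l => by
    have h := sum_evalForest_forestGrafts f T l (fun l' => brace K l' (f v))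
      ((brace_multilinear K).comp (LinearMap.applyₗ (f v)))
    rw [grafts, List.map_cons, List.sum_cons, List.map_map, evalTree, evalTree,
      evalForest, brace_cons, ← h]
    simp [Function.comp_def, evalTree]

theorem sum_evalForest_forestGrafts (f : V →ₗ[K] A) (T : PTree V) :
    ∀ (l : List (PTree V)) (g : List A → A), IsMultilinear K g →
      ((forestGrafts l T).map fun l' => g (evalForest f l')).sum
        = leibniz (evalTree f T) g (evalForest f l)
  | [], g, _ => by simp [forestGrafts, evalForest]
  | S :: l, g, hg => by
    have e : g ((evalTree f S * evalTree f T) :: evalForest f l)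
        = ((grafts S T).map fun S' => g (evalTree f S' :: evalForest f l)).sum := by
      rw [← sum_evalTree_grafts f T S]
      have := map_list_sum ((hg [] (evalForest f l)).mk' _) ((grafts S T).map (evalTree f))
      simpa [Function.comp_def] using this
    rw [forestGrafts, evalForest, leibniz_cons, e,
      ← sum_evalForest_forestGrafts f T l _ (hg.cons (evalTree f S))]
    simp [Function.comp_def, evalForest]

end

theorem evalTree_rel (f : V →ₗ[K] A) (x : PTree V →₀ K) (h : RTRel K V x) :
    Finsupp.linearCombination K (evalTree f) x = 0 := by
  induction h with
  | perm v l l' h =>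
    simp only [map_sub, Finsupp.linearCombination_single, one_smul, evalTree_node]
    rw [brace_perm K (h.map _), sub_self]
  | add_label v w l => simp [evalTree_node]
  | smul_label c v l => simp [evalTree_node]
  | child v l x h ih =>
    let B : A →ₗ[K] A := (((brace_multilinear K).comp
      (LinearMap.applyₗ (f v) : (A →ₗ[K] A) →ₗ[K] A)) [] (l.map (evalTree f))).mk' _
    have key : ∀ S, evalTree f (node v (S :: l)) = B (evalTree f S) := fun S => by
      rw [evalTree_node]; rfl
    rw [Finsupp.lmapDomain_apply, Finsupp.linearCombination_mapDomain]
    simp only [Function.comp_def, key]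
    rw [RT.linearCombination_comp, ih, map_zero]

/-- The linear extension to `RT(V)` of the evaluation of trees. -/
noncomputable def eval (f : V →ₗ[K] A) : RT K V →ₗ[K] A := RT.lift (evalTree f) (evalTree_rel f)

theorem eval_tree (f : V →ₗ[K] A) (T : PTree V) : eval f (RT.tree K T) = evalTree f T :=
  RT.lift_tree _ _ _

theorem RT.hom_ext {M : Type*} [AddCommGroup M] [Module K M] {F G : RT K V →ₗ[K] M}
    (h : ∀ T, F (RT.tree K T) = G (RT.tree K T)) : F = G := by
  ext T
  exact h T

theorem eval_graft (f : V →ₗ[K] A) (x y : RT K V) :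
    eval f (RT.graft K V x y) = eval f x * eval f y := by
  have : (RT.graft K V).compr₂ (eval f) = (LinearMap.mul K A).compl₁₂ (eval f) (eval f) := by
    refine RT.hom_ext fun S => RT.hom_ext fun T => ?_
    simp only [LinearMap.compr₂_apply, LinearMap.compl₁₂_apply, LinearMap.mul_apply',
      RT.graft_tree, map_list_sum, eval_tree, List.map_map, Function.comp_def,
      ← sum_evalTree_grafts]
  exact LinearMap.congr_fun₂ this x y

theorem map_evalTree {B : Type*} [RightPreLieRing B] [RightPreLieAlgebra K B] (f : V →ₗ[K] A)
    (g : V →ₗ[K] B) (F : A →ₙₐ[K] B) (h : ∀ v, F (f v) = g v) :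
    ∀ T : PTree V, F (evalTree f T) = evalTree g T
  | node v l => by
    have : ∀ T ∈ l, F (evalTree f T) = evalTree g T := fun T _ => map_evalTree f g F h T
    rw [evalTree_node, evalTree_node, map_brace, h, List.map_map]
    congr 2
    exact List.map_congr_left this

theorem map_map_cutSum (f : V →ₗ[K] A) (v : V) (p l : List (PTree V)) :
    TensorProduct.map (eval f) (eval f) (RT.cutSum K v p l)
      = listCut K (fun l' => brace K (p.map (evalTree f) ++ l') (f v)) (l.map (evalTree f)) := by
  induction l generalizing p with
  | nil => simp [RT.cutSum]
  | cons T l ih =>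
    rw [RT.cutSum_cons, map_add, ih, List.map_cons, listCut_cons, TensorProduct.map_tmul,
      eval_tree, eval_tree, evalTree_node]
    simp

/-- The evaluation of trees with primitive decorations is a morphism of coalgebras. -/
theorem coproduct_eval {Δ : A →ₗ[K] A ⊗[K] A} (h : IsCompatible Δ) {f : V →ₗ[K] A}
    (hf : ∀ v, Δ (f v) = 0) (x : RT K V) :
    Δ (eval f x) = TensorProduct.map (eval f) (eval f) (RT.coproduct K V x) := by
  have : Δ ∘ₗ eval f = TensorProduct.map (eval f) (eval f) ∘ₗ RT.coproduct K V := by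
    refine RT.hom_ext fun ⟨v, l⟩ => ?_
    rw [LinearMap.comp_apply, LinearMap.comp_apply, eval_tree, evalTree_node,
      coproduct_brace h (hf v), RT.coproduct, RT.lift_tree, RT.cut_node, map_map_cutSum]
    simp
  exact LinearMap.congr_fun this x

end Eval

end NAP

namespace NAP

/-! ### The root grafting product and the structure of the coalgebra `RT(V)` -/

namespace RT

open PTree

variable {K : Type*} [Field K] {V : Type*} [AddCommGroup V] [Module K V]

/-- The operator multiplying a tree with `n` subtrees at the root by `c n`. -/
noncomputable def arityScale (c : ℕ → K) : RT K V →ₗ[K] RT K V :=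
  lift (fun | node v l => c l.length • tree K (node v l)) fun x h => by
    induction h with
    | perm v l l' h => simp [h.length_eq, tree_perm v h]
    | add_label v w l => simp [tree_add_label]
    | smul_label a v l => simp [tree_smul_label, smul_comm a]
    | child v l x h _ =>
      rw [Finsupp.lmapDomain_apply, Finsupp.linearCombination_mapDomain]
      simp only [Function.comp_def, List.length_cons, ← attach_tree]
      have := linearCombination_tree_comp (c (l.length + 1) • attach v l) h
      simpa only [LinearMap.smul_apply] using this

theorem arityScale_tree (c : ℕ → K) (v : V) (l : List (PTree V)) :
    arityScale c (tree K (node v l)) = c l.length • tree K (node v l) := lift_tree _ _ _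

theorem arityScale_arityScale (c d : ℕ → K) (x : RT K V) :
    arityScale c (arityScale d x) = arityScale (fun n => c n * d n) x := by
  have : arityScale c ∘ₗ arityScale d = arityScale (V := V) fun n => c n * d n :=
    hom_ext fun ⟨v, l⟩ => by
      simp [arityScale_tree, smul_smul, mul_comm]
  exact LinearMap.congr_fun this x

theorem arityScale_one : arityScale (fun _ => (1 : K)) = (LinearMap.id : RT K V →ₗ[K] RT K V) :=
  hom_ext fun ⟨v, l⟩ => by simp [arityScale_tree]

theorem arityScale_add (c d : ℕ → K) :
    arityScale (V := V) (fun n => c n + d n) = arityScale c + arityScale d :=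
  hom_ext fun ⟨v, l⟩ => by simp [arityScale_tree, add_smul]

/-- The one-vertex trees. -/
noncomputable def ofLabel : V →ₗ[K] RT K V where
  toFun v := tree K (node v [])
  map_add' v w := tree_add_label v w []
  map_smul' c v := tree_smul_label c v []

theorem ofLabel_apply (v : V) : ofLabel v = tree K (node v []) := rfl

/-- The projection of `RT(V)` onto `V` killing the trees with more than one vertex. -/
noncomputable def label : RT K V →ₗ[K] V :=
  lift (fun | node v l => if l = [] then v else 0) fun x h => by
    induction h with
    | perm v l l' h =>
      have : l = [] ↔ l' = [] := by
        rw [← List.length_eq_zero_iff, ← List.length_eq_zero_iff, h.length_eq]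
      simp [this]
    | add_label v w l => by_cases hl : l = [] <;> simp [hl]
    | smul_label a v l => by_cases hl : l = [] <;> simp [hl]
    | child v l x h _ =>
      rw [Finsupp.lmapDomain_apply, Finsupp.linearCombination_mapDomain]
      simp [Function.comp_def, Finsupp.linearCombination_apply]

theorem label_tree (v : V) (l : List (PTree V)) :
    label (tree K (node v l)) = if l = [] then v else 0 := lift_tree _ _ _

theorem label_ofLabel (v : V) : label (ofLabel v : RT K V) = v := by
  simp [ofLabel_apply, label_tree]

theorem ofLabel_label (x : RT K V) :
    ofLabel (label x) = arityScale (fun n => if n = 0 then 1 else 0) x := by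
  have : ofLabel ∘ₗ label = arityScale (V := V) (K := K) fun n => if n = 0 then 1 else 0 :=
    hom_ext fun ⟨v, l⟩ => by
      by_cases hl : l = []
      · subst hl; simp [label_tree, arityScale_tree, ofLabel_apply]
      · simp [label_tree, arityScale_tree, hl]
  exact LinearMap.congr_fun this x

theorem coproduct_ofLabel (v : V) : coproduct K V (ofLabel v) = 0 := by
  rw [ofLabel_apply, coproduct_tree]
  rfl

variable (K V) in
/-- The product of `RT(V)` grafting the second tree on the root of the first one. -/
noncomputable def rootGraft : RT K V →ₗ[K] RT K V →ₗ[K] RT K V :=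
  lift (fun | node v l => attach v l) fun x h => by
    refine hom_ext fun T => ?_
    rw [LinearMap.zero_apply]
    induction h with
    | perm v l l' h => simp [attach_perm v h]
    | add_label v w l => simp [attach_tree, tree_add_label]
    | smul_label a v l => simp [attach_tree, tree_smul_label]
    | child v l x h _ =>
      let E : (RT K V →ₗ[K] RT K V) →ₗ[K] RT K V := LinearMap.applyₗ (tree K T)
      change E _ = 0
      rw [Finsupp.lmapDomain_apply, Finsupp.linearCombination_mapDomain,
        ← linearCombination_comp]
      simp only [E, Function.comp_def, LinearMap.applyₗ_apply_apply, attach_tree]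
      simp only [tree_perm v (List.Perm.swap _ T l), ← attach_tree]
      exact linearCombination_tree_comp (attach v (T :: l)) h

theorem rootGraft_tree (v : V) (l : List (PTree V)) (T : PTree V) :
    rootGraft K V (tree K (node v l)) (tree K T) = tree K (node v (T :: l)) := by
  rw [rootGraft, lift_tree, attach_tree]

variable (K V) in
/-- The root grafting product as a linear map on the tensor square. -/
noncomputable def rootMul : RT K V ⊗[K] RT K V →ₗ[K] RT K V := TensorProduct.lift (rootGraft K V)

theorem coproduct_tree_cutSum (v : V) (l : List (PTree V)) :
    coproduct K V (tree K (node v l)) = cutSum K v [] l := by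
  rw [coproduct, lift_tree, cut_node]

theorem rootMul_cutSum (v : V) (p l : List (PTree V)) :
    rootMul K V (cutSum K v p l) = (l.length : K) • tree K (node v (p ++ l)) := by
  induction l generalizing p with
  | nil => simp [cutSum]
  | cons T l ih =>
    rw [cutSum_cons, map_add, ih, rootMul, TensorProduct.lift.tmul, rootGraft_tree,
      ← tree_perm v (List.perm_middle (a := T) (l₁ := p) (l₂ := l))]
    simp [add_smul, add_comm]

theorem rootMul_coproduct (x : RT K V) :
    rootMul K V (coproduct K V x) = arityScale (fun n => (n : K)) x := by
  have : rootMul K V ∘ₗ coproduct K V = arityScale fun n => (n : K) :=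
    hom_ext fun ⟨v, l⟩ => by
      simp [coproduct_tree_cutSum, rootMul_cutSum, arityScale_tree]
  exact LinearMap.congr_fun this x

theorem cutSum_arityScale (c : ℕ → K) (v : V) (p l : List (PTree V)) :
    (arityScale c).rTensor (RT K V) (cutSum K v p l)
      = c (p.length + l.length - 1) • cutSum K v p l := by
  induction l generalizing p with
  | nil => simp [cutSum]
  | cons T l ih =>
    rw [cutSum_cons, map_add, ih, LinearMap.rTensor_tmul, arityScale_tree]
    simp [add_assoc, add_comm 1, TensorProduct.smul_tmul']

theorem cutSum_cons_left (v : V) (T : PTree V) (p l : List (PTree V)) :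
    cutSum K v (T :: p) l = (rootMul K V).rTensor (RT K V)
      (TensorProduct.rightComm K _ _ _ (cutSum K v p l ⊗ₜ[K] tree K T)) := by
  induction l generalizing p with
  | nil => simp [cutSum]
  | cons S l ih =>
    rw [cutSum_cons, cutSum_cons, TensorProduct.add_tmul, map_add, map_add, ← ih,
      TensorProduct.rightComm_tmul, LinearMap.rTensor_tmul, rootMul, TensorProduct.lift.tmul,
      rootGraft_tree]
    rfl

theorem coproduct_rootMul (z : RT K V ⊗[K] RT K V) :
    coproduct K V (rootMul K V z) = z + (rootMul K V).rTensor (RT K V)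
      (TensorProduct.rightComm K _ _ _ ((coproduct K V).rTensor (RT K V) z)) := by
  have : coproduct K V ∘ₗ rootMul K V = LinearMap.id + (rootMul K V).rTensor (RT K V) ∘ₗ
      (TensorProduct.rightComm K _ _ _).toLinearMap ∘ₗ (coproduct K V).rTensor (RT K V) := by
    refine TensorProduct.ext (hom_ext fun S => hom_ext fun T => ?_)
    obtain ⟨v, l⟩ := S
    change coproduct K V (rootMul K V (tree K (node v l) ⊗ₜ[K] tree K T))
      = tree K (node v l) ⊗ₜ[K] tree K T + (rootMul K V).rTensor (RT K V)
        (TensorProduct.rightComm K _ _ _ (coproduct K V (tree K (node v l)) ⊗ₜ[K] tree K T))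
    rw [coproduct_tree_cutSum, ← cutSum_cons_left, rootMul, TensorProduct.lift.tmul, rootGraft_tree, coproduct_tree_cutSum, cutSum_cons]
    rfl
  exact LinearMap.congr_fun this z

variable (K V) in
/-- A section of the coproduct over the tensors satisfying the coassociativity relation of a
nonassociative permutative coproduct. -/
noncomputable def cutSection : RT K V ⊗[K] RT K V →ₗ[K] RT K V :=
  rootMul K V ∘ₗ (arityScale fun n => ((n : K) + 1)⁻¹).rTensor (RT K V)

theorem coproduct_cutSection [CharZero K] {z : RT K V ⊗[K] RT K V}
    (hz : TensorProduct.rightComm K _ _ _ ((coproduct K V).rTensor (RT K V) z)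
      = (coproduct K V).rTensor (RT K V) z) :
    coproduct K V (cutSection K V z) = z := by
  set D : RT K V →ₗ[K] RT K V := arityScale fun n => ((n : K) + 1)⁻¹ with hD
  obtain ⟨E, hE⟩ : ∃ E : RT K V →ₗ[K] RT K V,
      coproduct K V ∘ₗ D = E.rTensor (RT K V) ∘ₗ coproduct K V := by
    refine ⟨arityScale fun n => ((n : K) + 1 + 1)⁻¹, ?_⟩
    refine hom_ext fun ⟨v, l⟩ => ?_
    simp only [LinearMap.comp_apply, hD, arityScale_tree, coproduct_tree_cutSum, map_smul,
      cutSum_arityScale]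
    cases l <;> simp [cutSum]
  have hcomm : ∀ w : (RT K V ⊗[K] RT K V) ⊗[K] RT K V,
      TensorProduct.rightComm K _ _ _ ((E.rTensor (RT K V)).rTensor (RT K V) w)
        = (E.rTensor (RT K V)).rTensor (RT K V) (TensorProduct.rightComm K _ _ _ w) := by
    intro w
    have : (TensorProduct.rightComm K _ _ _).toLinearMap ∘ₗ
        (E.rTensor (RT K V)).rTensor (RT K V)
        = (E.rTensor (RT K V)).rTensor (RT K V) ∘ₗ
          (TensorProduct.rightComm K _ _ _).toLinearMap :=
      TensorProduct.ext_threefold fun _ _ _ => rfl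
    exact LinearMap.congr_fun this w
  have hDz : (coproduct K V).rTensor (RT K V) (D.rTensor (RT K V) z)
      = (E.rTensor (RT K V)).rTensor (RT K V) ((coproduct K V).rTensor (RT K V) z) := by
    rw [← LinearMap.comp_apply, ← LinearMap.rTensor_comp, hE, LinearMap.rTensor_comp]
    rfl
  have hN : rootMul K V ∘ₗ coproduct K V = arityScale fun n => (n : K) :=
    LinearMap.ext rootMul_coproduct
  rw [cutSection, LinearMap.comp_apply, coproduct_rootMul, hDz, hcomm, hz, ← hDz,
    ← LinearMap.comp_apply, ← LinearMap.rTensor_comp, hN]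
  have h1 : (LinearMap.id + arityScale fun n => (n : K)) ∘ₗ D = LinearMap.id := by
    refine hom_ext fun ⟨v, l⟩ => ?_
    have : (l.length : K) + 1 ≠ 0 := by exact_mod_cast l.length.succ_ne_zero
    simp only [LinearMap.comp_apply, hD, arityScale_tree, map_smul, LinearMap.add_apply,
      LinearMap.id_apply]
    rw [show tree K (node v l) + (l.length : K) • tree K (node v l)
      = (1 + (l.length : K)) • tree K (node v l) by rw [add_smul, one_smul], smul_smul, add_comm 1, inv_mul_cancel₀ this, one_smul]
  have h2 := LinearMap.congr_fun (congrArg (LinearMap.rTensor (RT K V)) h1) z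
  rw [LinearMap.rTensor_comp, LinearMap.rTensor_add, LinearMap.rTensor_id] at h2
  simpa using h2

theorem ofLabel_label_of_coproduct_eq_zero [CharZero K] {x : RT K V}
    (h : coproduct K V x = 0) : ofLabel (label x) = x := by
  have h0 : arityScale (fun n => (n : K)) x = 0 := by rw [← rootMul_coproduct, h, map_zero]
  have h1 := arityScale_arityScale (fun n => (n : K)⁻¹) (fun n => (n : K)) x
  rw [h0, map_zero] at h1
  have h2 := LinearMap.congr_fun (arityScale_add (V := V) (fun n => if n = 0 then (1 : K) else 0)
    (fun n => (n : K)⁻¹ * n)) x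
  rw [LinearMap.add_apply, ← h1, add_zero, ← ofLabel_label] at h2
  rw [← h2]
  have : (fun n : ℕ => (if n = 0 then (1 : K) else 0) + (n : K)⁻¹ * n) = fun _ => 1 := by
    funext n
    by_cases hn : n = 0 <;> simp [hn]
  rw [this, arityScale_one, LinearMap.id_apply]

end RT

end NAP

namespace NAP

/-! ### Conilpotency -/

section Conilpotent

variable {K : Type*} [Field K] {C : Type*} [AddCommGroup C] [Module K C]
  {D : Type*} [AddCommGroup D] [Module K D]

/-- The image of `W ⊗ W` in `C ⊗ C`. -/
def tensorSq (W : Submodule K C) : Submodule K (C ⊗[K] C) :=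
  LinearMap.range (TensorProduct.mapIncl W W)

theorem tmul_mem_tensorSq {W : Submodule K C} {x y : C} (hx : x ∈ W) (hy : y ∈ W) :
    x ⊗ₜ[K] y ∈ tensorSq W := ⟨⟨x, hx⟩ ⊗ₜ ⟨y, hy⟩, rfl⟩

theorem range_mapIncl_le_tensorSq {U U' W : Submodule K C} (h : U ≤ W) (h' : U' ≤ W) :
    LinearMap.range (TensorProduct.mapIncl U U') ≤ tensorSq W := by
  rintro _ ⟨w, rfl⟩
  induction w with
  | zero => simp
  | tmul a b => exact tmul_mem_tensorSq (h a.2) (h' b.2)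
  | add a b ha hb => rw [map_add]; exact add_mem ha hb

theorem tensorSq_mono {U W : Submodule K C} (h : U ≤ W) : tensorSq U ≤ tensorSq W :=
  range_mapIncl_le_tensorSq h h

theorem map_eq_map_of_mem_tensorSq {E : Type*} [AddCommGroup E] [Module K E]
    {W : Submodule K C} {f f' : C →ₗ[K] D} {g g' : C →ₗ[K] E}
    (hf : ∀ x ∈ W, f x = f' x) (hg : ∀ x ∈ W, g x = g' x) {z : C ⊗[K] C} (hz : z ∈ tensorSq W) :
    TensorProduct.map f g z = TensorProduct.map f' g' z := by
  obtain ⟨w, rfl⟩ := hz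
  induction w with
  | zero => simp
  | tmul a b => simp [TensorProduct.mapIncl, hf a a.2, hg b b.2]
  | add a b ha hb => rw [map_add, map_add, map_add, ha, hb]

theorem exists_map_eq_of_mem_tensorSq_range (φ : D →ₗ[K] C) {z : C ⊗[K] C}
    (hz : z ∈ tensorSq (LinearMap.range φ)) : ∃ y, TensorProduct.map φ φ y = z := by
  obtain ⟨w, rfl⟩ := hz
  induction w with
  | zero => exact ⟨0, by simp⟩
  | tmul a b =>
    obtain ⟨_, a, rfl⟩ := a
    obtain ⟨_, b, rfl⟩ := b
    exact ⟨a ⊗ₜ b, rfl⟩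
  | add a b ha hb =>
    obtain ⟨a', ha⟩ := ha
    obtain ⟨b', hb⟩ := hb
    exact ⟨a' + b', by rw [map_add, map_add, ha, hb]⟩

/-- The filtration `G₀ = 0`, `Gₙ₊₁ = {x | Δ x ∈ Gₙ ⊗ Gₙ}` attached to a coproduct. -/
def conil (Δ : C →ₗ[K] C ⊗[K] C) : ℕ → Submodule K C
  | 0 => ⊥
  | n + 1 => (tensorSq (conil Δ n)).comap Δ

variable {Δ : C →ₗ[K] C ⊗[K] C}

theorem conil_le_succ (n : ℕ) : conil Δ n ≤ conil Δ (n + 1) := by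
  induction n with
  | zero => exact bot_le
  | succ n ih => exact Submodule.comap_mono (tensorSq_mono ih)

theorem conil_mono : Monotone (conil Δ) := monotone_nat_of_le_succ conil_le_succ

theorem filtration_le_conil (n : ℕ) : filtration Δ n ≤ conil Δ (n + 1) := by
  induction n using Nat.strong_induction_on with
  | _ n ih =>
    rw [filtration]
    refine Submodule.comap_mono (iSup_le fun i => range_mapIncl_le_tensorSq ?_ ?_)
    · exact (ih _ (by omega)).trans (conil_mono (by omega))
    · exact (ih _ (by omega)).trans (conil_mono (by omega))

/-- Every element lies in a step of the filtration `conil Δ`. -/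
def IsConilpotent (Δ : C →ₗ[K] C ⊗[K] C) : Prop := ∀ x, ∃ n, x ∈ conil Δ n

theorem IsConnected.isConilpotent (h : IsConnected Δ) : IsConilpotent Δ := fun x => by
  obtain ⟨n, -, hx⟩ := h x
  exact ⟨n + 1, filtration_le_conil n hx⟩

theorem IsConilpotent.mem_of_closed (h : IsConilpotent Δ) {W : Submodule K C}
    (hW : ∀ x, Δ x ∈ tensorSq W → x ∈ W) (x : C) : x ∈ W := by
  have key : ∀ n, conil Δ n ≤ W := by
    intro n
    induction n with
    | zero => exact bot_le
    | succ n ih => exact fun x hx => hW x (tensorSq_mono ih hx)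
  obtain ⟨n, hx⟩ := h x
  exact key n hx

theorem mem_iSup_conil {x : C} : x ∈ ⨆ n, conil Δ n ↔ ∃ n, x ∈ conil Δ n :=
  Submodule.mem_iSup_of_directed _ conil_mono.directed_le

theorem mem_iSup_conil_of_coproduct_mem {x : C} (hx : Δ x ∈ tensorSq (⨆ n, conil Δ n)) :
    x ∈ ⨆ n, conil Δ n := by
  suffices ∀ w, ∃ n, TensorProduct.mapIncl (⨆ n, conil Δ n) (⨆ n, conil Δ n) w
      ∈ tensorSq (conil Δ n) by
    obtain ⟨w, hw⟩ := hx
    obtain ⟨n, hn⟩ := this w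
    exact mem_iSup_conil.2 ⟨n + 1, by rw [hw] at hn; exact hn⟩
  intro w
  induction w with
  | zero => exact ⟨0, by simp⟩
  | tmul a b =>
    obtain ⟨n, hn⟩ := mem_iSup_conil.1 a.2
    obtain ⟨m, hm⟩ := mem_iSup_conil.1 b.2
    exact ⟨max n m, tmul_mem_tensorSq (conil_mono (le_max_left _ _) hn)
      (conil_mono (le_max_right _ _) hm)⟩
  | add a b ha hb =>
    obtain ⟨n, hn⟩ := ha
    obtain ⟨m, hm⟩ := hb
    refine ⟨max n m, ?_⟩
    rw [map_add]
    exact add_mem (tensorSq_mono (conil_mono (le_max_left _ _)) hn)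
      (tensorSq_mono (conil_mono (le_max_right _ _)) hm)

/-- A compatible family of linear maps on an exhaustive filtration has a limit. -/
theorem exists_linearMap_of_eventually_constant {G : ℕ → Submodule K C} (hG : Monotone G)
    (hex : ∀ x, ∃ n, x ∈ G n) (F : ℕ → C →ₗ[K] D)
    (hF : ∀ n m x, n ≤ m → x ∈ G n → F m x = F n x) :
    ∃ F' : C →ₗ[K] D, ∀ n, ∀ x ∈ G n, F' x = F n x := by
  choose N hN using hex
  have key : ∀ n, ∀ x ∈ G n, F (N x) x = F n x := fun n x hx => by
    rw [← hF _ _ x (le_max_left (N x) n) (hN x), ← hF _ _ x (le_max_right (N x) n) hx]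
  refine ⟨{ toFun := fun x => F (N x) x, map_add' := fun x y => ?_, map_smul' := fun c x => ?_ },
    key⟩
  · have hx := hG (le_max_left (N x) (N y)) (hN x)
    have hy := hG (le_max_right (N x) (N y)) (hN y)
    rw [key _ _ (add_mem hx hy), key _ x hx, key _ y hy, map_add]
  · rw [key _ _ (Submodule.smul_mem _ c (hN x)), map_smul]
    rfl

/-- A morphism from a connected coalgebra is injective if it is so on the primitive elements. -/
theorem IsConilpotent.injective (h : IsConilpotent Δ) {Δ' : D →ₗ[K] D ⊗[K] D} {φ : C →ₗ[K] D}
    (hφ : ∀ x, Δ' (φ x) = TensorProduct.map φ φ (Δ x))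
    (hprim : ∀ x, Δ x = 0 → φ x = 0 → x = 0) : Function.Injective φ := by
  have key : ∀ n, ∀ x ∈ conil Δ n, φ x = 0 → x = 0 := by
    intro n
    induction n with
    | zero => exact fun x hx _ => hx
    | succ n ih =>
      intro x hx h0
      obtain ⟨w, hw⟩ := hx
      have hinj : Function.Injective (φ ∘ₗ (conil Δ n).subtype) :=
        (injective_iff_map_eq_zero _).2 fun y hy => Subtype.ext (ih y y.2 hy)
      have hw0 : TensorProduct.map (φ ∘ₗ (conil Δ n).subtype) (φ ∘ₗ (conil Δ n).subtype) w = 0 := by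
        rw [TensorProduct.map_comp, LinearMap.comp_apply]
        refine (congrArg _ hw).trans ?_
        rw [← hφ, h0, map_zero]
      have : w = 0 := TensorProduct.map_injective_of_flat_flat _ _ hinj hinj
        (hw0.trans (map_zero _).symm)
      exact hprim x (by rw [← hw, this, map_zero]) h0
  refine (injective_iff_map_eq_zero _).2 fun x hx => ?_
  obtain ⟨n, hn⟩ := h x
  exact key n x hn hx

theorem rightComm_map {E : Type*} [AddCommGroup E] [Module K E] (φ : C →ₗ[K] D) (ψ ψ' : C →ₗ[K] E)
    (w : (C ⊗[K] C) ⊗[K] C) :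
    TensorProduct.rightComm K _ _ _ (TensorProduct.map (TensorProduct.map φ ψ) ψ' w)
      = TensorProduct.map (TensorProduct.map φ ψ') ψ (TensorProduct.rightComm K _ _ _ w) := by
  have : (TensorProduct.rightComm K _ _ _).toLinearMap ∘ₗ
      TensorProduct.map (TensorProduct.map φ ψ) ψ'
      = TensorProduct.map (TensorProduct.map φ ψ') ψ ∘ₗ
        (TensorProduct.rightComm K _ _ _).toLinearMap :=
    TensorProduct.ext_threefold fun _ _ _ => rfl
  exact LinearMap.congr_fun this w

end Conilpotent

/-! ### Cofreeness of `RT(V)` -/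

namespace RT

open PTree

variable {K : Type*} [Field K] {V : Type*} [AddCommGroup V] [Module K V]

theorem tree_mem_of_closed {W : Submodule K (RT K V)}
    (hW : ∀ x, coproduct K V x ∈ tensorSq W → x ∈ W) : ∀ T : PTree V, tree K T ∈ W
  | node v l => by
    have hl : ∀ T ∈ l, tree K T ∈ W := fun T _ => tree_mem_of_closed hW T
    induction hn : l.length generalizing l with
    | zero =>
      obtain rfl : l = [] := List.length_eq_zero_iff.1 hn
      exact hW _ (by rw [coproduct_tree]; exact zero_mem _)
    | succ n ih =>
      refine hW _ ?_
      rw [coproduct_tree]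
      refine sum_mem fun i _ => tmul_mem_tensorSq (ih _ (fun T hT => ?_) ?_) (hl _ ?_)
      · exact hl T (List.mem_of_mem_eraseIdx hT)
      · rw [List.length_eraseIdx_of_lt i.2, hn]; rfl
      · exact List.get_mem _ _

theorem isConilpotent : IsConilpotent (coproduct K V) := by
  intro x
  rw [← mem_iSup_conil]
  obtain ⟨y, rfl⟩ := Submodule.mkQ_surjective _ x
  rw [← linearCombination_tree, Finsupp.linearCombination_apply]
  exact sum_mem fun T _ => Submodule.smul_mem _ _
    (tree_mem_of_closed (fun _ => mem_iSup_conil_of_coproduct_mem) T)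

theorem label_cutSection (z : RT K V ⊗[K] RT K V) : label (cutSection K V z) = 0 := by
  have : label ∘ₗ rootMul K V = 0 := by
    refine TensorProduct.ext (hom_ext fun S => hom_ext fun T => ?_)
    obtain ⟨v, l⟩ := S
    change label (rootGraft K V (tree K (node v l)) (tree K T)) = 0
    rw [rootGraft_tree, label_tree, if_neg (by simp)]
  exact LinearMap.congr_fun this _

variable {C : Type*} [AddCommGroup C] [Module K C] {δ : C →ₗ[K] C ⊗[K] C}

/-- Successive approximations of the morphism of coalgebras `C → RT(V)` lifting `f : C → V`. -/
noncomputable def coliftAux (δ : C →ₗ[K] C ⊗[K] C) (f : C →ₗ[K] V) : ℕ → C →ₗ[K] RT K V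
  | 0 => 0
  | n + 1 => ofLabel ∘ₗ f
      + cutSection K V ∘ₗ TensorProduct.map (coliftAux δ f n) (coliftAux δ f n) ∘ₗ δ

theorem coliftAux_succ_apply (f : C →ₗ[K] V) (n : ℕ) (x : C) :
    coliftAux δ f (n + 1) x = ofLabel (f x)
      + cutSection K V (TensorProduct.map (coliftAux δ f n) (coliftAux δ f n) (δ x)) := rfl

theorem coliftAux_succ_of_mem (f : C →ₗ[K] V) (n : ℕ) :
    ∀ x ∈ conil δ n, coliftAux δ f (n + 1) x = coliftAux δ f n x := by
  induction n with
  | zero =>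
    intro x hx
    rw [(Submodule.mem_bot K).1 hx, map_zero, map_zero]
  | succ n ih =>
    intro x hx
    rw [coliftAux_succ_apply, coliftAux_succ_apply, map_eq_map_of_mem_tensorSq ih ih hx]

theorem coliftAux_of_mem (f : C →ₗ[K] V) (n m : ℕ) (x : C) (h : n ≤ m) (hx : x ∈ conil δ n) :
    coliftAux δ f m x = coliftAux δ f n x := by
  induction m, h using Nat.le_induction with
  | base => rfl
  | succ m h ih => rw [coliftAux_succ_of_mem f m x (conil_mono h hx), ih]

theorem exists_colift [CharZero K] (hδ : IsNAPCoproduct δ) (hconn : IsConilpotent δ)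
    (f : C →ₗ[K] V) : ∃ F : C →ₗ[K] RT K V,
      (∀ x, coproduct K V (F x) = TensorProduct.map F F (δ x)) ∧ ∀ x, label (F x) = f x := by
  obtain ⟨F, hF⟩ := exists_linearMap_of_eventually_constant conil_mono hconn (coliftAux δ f)
    (coliftAux_of_mem f)
  have hfix : ∀ x, F x = ofLabel (f x) + cutSection K V (TensorProduct.map F F (δ x)) := by
    intro x
    obtain ⟨n, hn⟩ := hconn x
    have hx : x ∈ conil δ (n + 1) := conil_le_succ n hn
    rw [hF _ x hx, coliftAux_succ_apply, map_eq_map_of_mem_tensorSq (hF n) (hF n) hx]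
  refine ⟨F, fun x => ?_, fun x => ?_⟩
  · refine hconn.mem_of_closed
      (W := LinearMap.eqLocus (coproduct K V ∘ₗ F) (TensorProduct.map F F ∘ₗ δ)) (fun x hx => ?_) x
    change coproduct K V (F x) = TensorProduct.map F F (δ x)
    rw [hfix x, map_add, coproduct_ofLabel, zero_add]
    refine coproduct_cutSection ?_
    have e : (coproduct K V).rTensor (RT K V) (TensorProduct.map F F (δ x))
        = TensorProduct.map (TensorProduct.map F F) F (δ.rTensor C (δ x)) := by
      change ((coproduct K V).rTensor (RT K V) ∘ₗ TensorProduct.map F F) (δ x)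
        = (TensorProduct.map (TensorProduct.map F F) F ∘ₗ δ.rTensor C) (δ x)
      rw [LinearMap.rTensor_comp_map, LinearMap.map_comp_rTensor]
      exact map_eq_map_of_mem_tensorSq (fun _ h => h) (fun _ _ => rfl) hx
    rw [e, rightComm_map, hδ x]
  · rw [hfix x, map_add, label_ofLabel, label_cutSection, add_zero]

theorem colift_unique [CharZero K] (hconn : IsConilpotent δ) {F F' : C →ₗ[K] RT K V}
    (hF : ∀ x, coproduct K V (F x) = TensorProduct.map F F (δ x))
    (hF' : ∀ x, coproduct K V (F' x) = TensorProduct.map F' F' (δ x))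
    (h : ∀ x, label (F x) = label (F' x)) : F = F' := by
  refine LinearMap.ext (hconn.mem_of_closed (W := LinearMap.eqLocus F F') fun x hx => ?_)
  have h0 : coproduct K V (F x - F' x) = 0 := by
    rw [map_sub, hF, hF', sub_eq_zero]
    exact map_eq_map_of_mem_tensorSq (fun _ h => h) (fun _ h => h) hx
  have h1 := ofLabel_label_of_coproduct_eq_zero h0
  rw [map_sub, h, sub_self, map_zero] at h1
  exact sub_eq_zero.1 h1.symm

end RT

/-! ### The isomorphism with `RT(Prim H)` -/

section Rigidity

variable {K : Type*} [Field K] [CharZero K] {H : Type*} [RightPreLieRing H]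
  [RightPreLieAlgebra K H] {Δ : H →ₗ[K] H ⊗[K] H}

theorem eval_ofLabel {V : Type*} [AddCommGroup V] [Module K V] (f : V →ₗ[K] H) (v : V) :
    eval f (RT.ofLabel v) = f v := by
  rw [RT.ofLabel_apply, eval_tree, evalTree_node]
  rfl

theorem coproduct_eval_prim (hcompat : IsCompatible Δ) (x : RT K (Prim Δ)) :
    Δ (eval (Prim Δ).subtype x)
      = TensorProduct.map (eval (Prim Δ).subtype) (eval (Prim Δ).subtype)
        (RT.coproduct K (Prim Δ) x) :=
  coproduct_eval hcompat (fun v => v.2) x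

theorem eval_prim_injective (hcompat : IsCompatible Δ) :
    Function.Injective (eval (Prim Δ).subtype) := by
  refine RT.isConilpotent.injective (coproduct_eval_prim hcompat) fun x hx h0 => ?_
  have h := RT.ofLabel_label_of_coproduct_eq_zero hx
  have h1 := eval_ofLabel (Prim Δ).subtype (RT.label x)
  rw [h, h0] at h1
  have h2 : RT.label x = 0 := Subtype.ext h1.symm
  rw [← h, h2, map_zero]

theorem eval_prim_surjective (hΔ : IsNAPCoproduct Δ) (hconn : IsConilpotent Δ)
    (hcompat : IsCompatible Δ) : Function.Surjective (eval (Prim Δ).subtype) := by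
  set φ := eval (Prim Δ).subtype with hφ
  have hcop : ∀ x, Δ (φ x) = TensorProduct.map φ φ (RT.coproduct K (Prim Δ) x) :=
    coproduct_eval_prim hcompat
  have hcop' : Δ ∘ₗ φ = TensorProduct.map φ φ ∘ₗ RT.coproduct K (Prim Δ) := LinearMap.ext hcop
  have hinj : Function.Injective φ := eval_prim_injective hcompat
  refine hconn.mem_of_closed (W := LinearMap.range φ) fun x hx => ?_
  obtain ⟨z, hz⟩ := exists_map_eq_of_mem_tensorSq_range φ hx
  have e : TensorProduct.map (TensorProduct.map φ φ) φ
      ((RT.coproduct K (Prim Δ)).rTensor _ z) = Δ.rTensor H (Δ x) := by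
    rw [← hz]
    change (TensorProduct.map (TensorProduct.map φ φ) φ ∘ₗ
      (RT.coproduct K (Prim Δ)).rTensor _) z = (Δ.rTensor H ∘ₗ TensorProduct.map φ φ) z
    rw [LinearMap.map_comp_rTensor, LinearMap.rTensor_comp_map, hcop']
  have hsym : TensorProduct.rightComm K _ _ _ ((RT.coproduct K (Prim Δ)).rTensor _ z)
      = (RT.coproduct K (Prim Δ)).rTensor _ z := by
    have hinj₂ := TensorProduct.map_injective_of_flat_flat φ φ hinj hinj
    apply TensorProduct.map_injective_of_flat_flat _ _ hinj₂ hinj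
    rw [← rightComm_map, e, hΔ x]
  have hprim : Δ (x - φ (RT.cutSection K _ z)) = 0 := by
    rw [map_sub, hcop, RT.coproduct_cutSection hsym, hz, sub_self]
  refine ⟨RT.ofLabel ⟨_, hprim⟩ + RT.cutSection K _ z, ?_⟩
  rw [map_add]
  exact (congrArg (· + _) (eval_ofLabel (Prim Δ).subtype ⟨_, hprim⟩)).trans (sub_add_cancel _ _)

end Rigidity

end NAP

theorem theorem3p4 {K : Type*} [Field K] [CharZero K]
    {H : Type*} [RightPreLieRing H] [RightPreLieAlgebra K H]
    (Δ : H →ₗ[K] H ⊗[K] H) (hΔ : NAP.IsNAPCoproduct Δ) (hconn : NAP.IsConnected Δ)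
    (hcompat : NAP.IsCompatible Δ) :
    -- `H` is isomorphic to `RT(Prim H)` as a pre-Lie algebra and as a NAP coalgebra
    (∃ Φ : NAP.RT K (NAP.Prim Δ) ≃ₗ[K] H,
      (∀ v : NAP.Prim Δ, Φ (NAP.RT.tree K (NAP.PTree.node v [])) = v) ∧
      (∀ x y, Φ (NAP.RT.graft K (NAP.Prim Δ) x y) = Φ x * Φ y) ∧
      (∀ x, Δ (Φ x) =
        TensorProduct.map Φ.toLinearMap Φ.toLinearMap (NAP.RT.coproduct K (NAP.Prim Δ) x))) ∧
    -- `H` is the free pre-Lie algebra on `Prim H`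
    (∀ (L : Type*) [RightPreLieRing L] [RightPreLieAlgebra K L] (f : NAP.Prim Δ →ₗ[K] L),
      ∃! F : H →ₙₐ[K] L, ∀ v : NAP.Prim Δ, F v = f v) ∧
    -- `H` is the cofree connected NAP coalgebra on `Prim H`, for some projection onto `Prim H`
    (∃ p : H →ₗ[K] NAP.Prim Δ, (∀ v : NAP.Prim Δ, p v = v) ∧
      ∀ (C : Type*) [AddCommGroup C] [Module K C] (δ : C →ₗ[K] C ⊗[K] C),
        NAP.IsNAPCoproduct δ → NAP.IsConnected δ → ∀ f : C →ₗ[K] NAP.Prim Δ,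
          ∃! F : C →ₗ[K] H,
            (∀ x, Δ (F x) = TensorProduct.map F F (δ x)) ∧ ∀ x, p (F x) = f x) := by
  have hconn' := hconn.isConilpotent
  set ι := (NAP.Prim Δ).subtype with hι
  let Φ : NAP.RT K (NAP.Prim Δ) ≃ₗ[K] H := LinearEquiv.ofBijective (NAP.eval ι)
    ⟨NAP.eval_prim_injective hcompat, NAP.eval_prim_surjective hΔ hconn' hcompat⟩
  have hΦv : ∀ v : NAP.Prim Δ, Φ (NAP.RT.ofLabel v) = v := NAP.eval_ofLabel ι
  have hΦm : ∀ x y, Φ (NAP.RT.graft K (NAP.Prim Δ) x y) = Φ x * Φ y := NAP.eval_graft ι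
  have hΦc : ∀ x, Δ (Φ x) =
      TensorProduct.map Φ.toLinearMap Φ.toLinearMap (NAP.RT.coproduct K (NAP.Prim Δ) x) :=
    NAP.coproduct_eval_prim hcompat
  have hΦc' : ∀ x, NAP.RT.coproduct K (NAP.Prim Δ) (Φ.symm x)
      = TensorProduct.map Φ.symm.toLinearMap Φ.symm.toLinearMap (Δ x) := by
    intro x
    obtain ⟨y, rfl⟩ := Φ.surjective x
    rw [hΦc, Φ.symm_apply_apply, ← LinearMap.comp_apply, ← TensorProduct.map_comp]
    simp
  refine ⟨⟨Φ, hΦv, hΦm, hΦc⟩, ?_, ?_⟩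
  · intro L _ _ f
    refine ⟨{ (NAP.eval f ∘ₗ Φ.symm.toLinearMap : H →ₗ[K] L) with
      map_zero' := (NAP.eval f ∘ₗ Φ.symm.toLinearMap).map_zero
      map_mul' := fun x y => ?_ }, fun v => ?_, fun F hF => ?_⟩
    · obtain ⟨x, rfl⟩ := Φ.surjective x
      obtain ⟨y, rfl⟩ := Φ.surjective y
      change NAP.eval f (Φ.symm (Φ x * Φ y))
        = NAP.eval f (Φ.symm (Φ x)) * NAP.eval f (Φ.symm (Φ y))
      rw [← hΦm]
      simp only [LinearEquiv.symm_apply_apply]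
      exact NAP.eval_graft f x y
    · change NAP.eval f (Φ.symm v) = f v
      rw [← hΦv, Φ.symm_apply_apply, NAP.eval_ofLabel]
    · have h : (F : H →ₗ[K] L) ∘ₗ Φ.toLinearMap = NAP.eval f :=
        NAP.RT.hom_ext fun T => by
          rw [NAP.eval_tree, ← NAP.map_evalTree ι f F hF T, ← NAP.eval_tree]
          rfl
      ext x
      obtain ⟨y, rfl⟩ := Φ.surjective x
      refine (LinearMap.congr_fun h y).trans ?_
      exact congrArg (NAP.eval f) (Φ.symm_apply_apply y).symm
  · refine ⟨NAP.RT.label ∘ₗ Φ.symm.toLinearMap, fun v => ?_, ?_⟩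
    · change NAP.RT.label (Φ.symm v) = v
      rw [← hΦv, Φ.symm_apply_apply, NAP.RT.label_ofLabel]
    · intro C _ _ δ hδ hδc f
      obtain ⟨F, hF, hFf⟩ := NAP.RT.exists_colift hδ hδc.isConilpotent f
      refine ⟨Φ.toLinearMap ∘ₗ F, ⟨fun x => ?_, fun x => ?_⟩, ?_⟩
      · rw [TensorProduct.map_comp, LinearMap.comp_apply, LinearMap.comp_apply, ← hF]
        exact hΦc (F x)
      · change NAP.RT.label (Φ.symm (Φ (F x))) = f x
        rw [Φ.symm_apply_apply, hFf]
      · rintro F' ⟨hF', hF'f⟩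
        have h : Φ.symm.toLinearMap ∘ₗ F' = F := by
          refine NAP.RT.colift_unique hδc.isConilpotent (fun x => ?_) hF fun x => ?_
          · rw [TensorProduct.map_comp, LinearMap.comp_apply, LinearMap.comp_apply, ← hF']
            exact hΦc' (F' x)
          · exact (hF'f x).trans (hFf x).symm
        ext x
        rw [← h]
        exact (Φ.apply_symm_apply (F' x)).symm
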